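/- Let $M$ be a compact connected $d$-dimensional smooth Riemannian manifold, $d\ge 2$ (possibly with boundary), with the norm $\|\cdot\|$ induced on its tangent bundle and the induced distance $\operatorname{dist}$, and let $f:M\to M$ be a $C^1$ diffeomorphism. For $x\in M$ and $k\in\mathbb Z^+$ write $$\tilde A^-_k(x)=\liminf_{n\to\infty}\frac1n\sum_{j=0}^{n-1}\ln\bigl\|\bigl(Df^k(f^{kj}x)\bigr)^{-1}\bigr\| .$$ A set $\{p,gp,\dots,g^{\tau-1}p\}$ with $\tau\in\mathbb Z^+$ and $g^\tau p=p$ (where $\tau$ need not be the least period of $p$) is an attracting periodic orbit of a map $g:M\to M$ if there are a neighborhood $V$ of $p$ with $g^\tau(V)\subset V$ and $0<\lambda<1$ such that $\operatorname{dist}(g^\tau q,g^\tau r)\le\lambda\operatorname{dist}(q,r)$ for all $q,r\in V$. A repelling periodic orbit (a source) of $f$ is an attracting periodic orbit of $f^{-1}$. Then $x\in M$ belongs to a repelling periodic orbit of $f$ if and only if $\tilde A^-_k(x)<0$ for some $k\in\mathbb Z^+$. -/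

import Mathlib

open Set Filter Topology Manifold ContDiff Bundle

/-- `O` is an attracting periodic orbit (a sink) of `g`: `O = {p, g p, …, g^{τ-1} p}` with `τ ≥ 1`
and `g^τ p = p`, and `g^τ` maps some neighbourhood `V` of `p` into itself as a contraction.
(`τ` is a period of `p`, not necessarily the least one.) -/
def IsAttractingPeriodicOrbit {X : Type*} [MetricSpace X] (g : X → X) (O : Set X) : Prop :=
  ∃ (p : X) (τ : ℕ), 0 < τ ∧ g^[τ] p = p ∧ O = {y | ∃ i < τ, y = g^[i] p} ∧
    ∃ V ∈ 𝓝 p, MapsTo (g^[τ]) V V ∧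
      ∃ c : ℝ, 0 < c ∧ c < 1 ∧ ∀ q ∈ V, ∀ r ∈ V, dist (g^[τ] q) (g^[τ] r) ≤ c * dist q r

/-- `O` is a repelling periodic orbit (a source) of the bijection `f`: an attracting periodic orbit
of `f⁻¹`. -/
def IsRepellingPeriodicOrbit {X : Type*} [MetricSpace X] (f : X ≃ X) (O : Set X) : Prop :=
  IsAttractingPeriodicOrbit f.symm O

section

variable {E : Type*} [NormedAddCommGroup E] [NormedSpace ℝ E]
  {H : Type*} [TopologicalSpace H] (I : ModelWithCorners ℝ E H)
  {M : Type*} [TopologicalSpace M] [ChartedSpace H M]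
  [RiemannianBundle (fun (x : M) ↦ TangentSpace I x)]

/-- `ln ‖(D f^k (y))⁻¹‖`, with the operator norm for the Riemannian norms on the tangent spaces.
(`ContinuousLinearMap.inverse` is the inverse map whenever the derivative is invertible.) -/
noncomputable def logNormInvDeriv (f : M → M) (k : ℕ) (y : M) : ℝ :=
  Real.log ‖(mfderiv I I (f^[k]) y).inverse‖

/-- `Ã⁻_k(x) = liminf_{n → ∞} (1/n) ∑_{j<n} ln ‖(D f^k (f^{kj} x))⁻¹‖`, as an extended real. -/
noncomputable def liminfAvgLogNormInvDeriv (f : M → M) (k : ℕ) (x : M) : EReal :=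
  liminf (fun n : ℕ ↦
    (((n : ℝ)⁻¹ * ∑ j ∈ Finset.range n, logNormInvDeriv I f k (f^[k * j] x) : ℝ) : EReal)) atTop

end

/-! Both directions pass through the derivative of `f⁻ᵏ`, since `(Df^k(y))⁻¹` is the derivative of
`f⁻ᵏ` at `f^k y`.

Negative exponent gives a source: put `g = f^k` and `a z = ln ‖Dg⁻¹(z)‖`. Along some subsequence the
Birkhoff sums of `a` decrease linearly. As in Pliss' lemma (`frequently_backward_average_le`), there
are then infinitely many hyperbolic times `n`, at which every backward average is negative. At such
times `g⁻¹, …, g⁻ⁿ` contract a ball around `g^n x` of radius independent of `n`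
(`dist_symm_iterate_le`). By compactness two such times, far apart, have nearby orbit points, so for
their difference `m` the map `g⁻ᵐ` contracts a ball into itself and has a fixed point `p` there. The
orbit of `x` returns to this ball infinitely often; pulling the returns back shows that `x` is on
the orbit of `p` (`exists_iterate_eq_of_frequently_mem`).

Conversely, on a source the Lipschitz constants at `x` of `f^(-τN)` decay like `c^N`. Charts turn
this into decay of the derivative norms up to a fixed factor (`eventually_norm_mfderiv_lt_one`), so
`k = τN` works for large `N`. -/

/-! ### Hyperbolic times and backward contraction in metric spaces. -/

/-- A real sequence that is frequently below `-c n` has infinitely many times `n` at which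
all the backward averages are at most `-c / 2`. -/
theorem frequently_backward_average_le {S : ℕ → ℝ} {c : ℝ} (hc : 0 < c)
    (h : ∃ᶠ n : ℕ in atTop, S n ≤ -c * n) :
    ∃ᶠ n : ℕ in atTop, ∀ j ≤ n, S n - S j ≤ -(c / 2) * ((n : ℝ) - j) := by
  set u : ℕ → ℝ := fun n ↦ S n + c / 2 * n with hu
  have hunb : ∀ B : ℝ, ∃ n, u n < B := by
    intro B
    obtain ⟨N, hN⟩ := exists_nat_gt (-B / (c / 2))
    obtain ⟨n, hn, hSn⟩ := (frequently_atTop.1 h) N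
    refine ⟨n, ?_⟩
    have h1 : -B < N * (c / 2) := by rwa [div_lt_iff₀ (by positivity)] at hN
    have h2 : (N : ℝ) * (c / 2) ≤ n * (c / 2) := by
      gcongr
    simp only [hu]
    linarith
  rw [frequently_atTop]
  intro N
  obtain ⟨B, hB⟩ : ∃ B, ∀ j < N, B ≤ u j := by
    obtain ⟨B, hB⟩ := ((Set.finite_lt_nat N).image u).bddBelow
    exact ⟨B, fun j hj ↦ hB ⟨j, hj, rfl⟩⟩
  classical
  have hex : ∃ n, u n < B := hunb B
  -- The first time `u` drops below `B` comes no earlier than `N`, and `u` is at least `B` at all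
  -- earlier times; this record minimum is the claim.
  refine ⟨Nat.find hex, ?_, ?_⟩
  · by_contra! hlt
    exact absurd (Nat.find_spec hex) (not_lt.2 (hB _ hlt))
  · intro j hj
    rcases hj.eq_or_lt with rfl | hj
    · simp
    have h1 := Nat.find_spec hex
    have h2 := not_lt.1 (Nat.find_min hex hj)
    have h3 : u (Nat.find hex) ≤ u j := h1.le.trans h2
    simp only [hu] at h3
    linarith

/-- Backward iterates of the ball around `g^n x` are contracted at a rate given by the backward
Birkhoff sums, provided these are negative enough. -/
theorem dist_symm_iterate_le {X : Type*} [MetricSpace X] (g : X ≃ X) (a : X → ℝ) {ε δ : ℝ}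
    (hδ : ∀ z q r, dist q z < δ → dist r z < δ →
      dist (g.symm q) (g.symm r) ≤ Real.exp (a z + ε) * dist q r)
    (x : X) {n : ℕ} (hε : 0 ≤ ε)
    (hn : ∀ j ≤ n, ∑ i ∈ Finset.range n, a (g^[i + 1] x) - ∑ i ∈ Finset.range j, a (g^[i + 1] x)
      ≤ -(2 * ε) * ((n : ℝ) - j)) (i : ℕ) (hi : i ≤ n) :
    ∀ q r, dist q (g^[n] x) < δ → dist r (g^[n] x) < δ →
      dist (g.symm^[i] q) (g.symm^[i] r) ≤ Real.exp (-ε * i) * dist q r := by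
  -- The induction keeps the exact Birkhoff sum in the exponent; `hn` bounds it by `-2εi`, which
  -- absorbs the accumulated error `εi`.
  have key : ∀ i ≤ n, ∀ q r, dist q (g^[n] x) < δ → dist r (g^[n] x) < δ →
      dist (g.symm^[i] q) (g.symm^[i] r) ≤
        Real.exp (∑ l ∈ Finset.range n, a (g^[l + 1] x) -
          ∑ l ∈ Finset.range (n - i), a (g^[l + 1] x) + ε * i) * dist q r := by
    intro i
    induction i with
    | zero => intro _ q r _ _; simp
    | succ i ih =>
      intro hi q r hq hr
      have ih' := ih (by omega)
      have hcent : g.symm^[i] (g^[n] x) = g^[n - i] x := by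
        conv_lhs => rw [show n = i + (n - i) by omega, Function.iterate_add_apply]
        exact (Function.LeftInverse.iterate g.left_inv i) _
      have hexp : Real.exp (∑ l ∈ Finset.range n, a (g^[l + 1] x) -
          ∑ l ∈ Finset.range (n - i), a (g^[l + 1] x) + ε * i) ≤ 1 := by
        rw [Real.exp_le_one_iff]
        have h1 := hn (n - i) (by omega)
        rw [Nat.cast_sub (by omega)] at h1
        have : 0 ≤ ε * i := by positivity
        nlinarith
      -- A nonpositive exponent keeps the backward iterates within `δ` of the orbit, so `hδ` applies
      -- once more.
      have hclose : ∀ p, dist p (g^[n] x) < δ → dist (g.symm^[i] p) (g^[n - i] x) < δ := by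
        intro p hp
        have h0 : dist (g^[n] x) (g^[n] x) < δ := by
          rw [dist_self]; exact dist_nonneg.trans_lt hp
        have h1 := ih' p _ hp h0
        rw [hcent] at h1
        exact h1.trans_lt ((mul_le_of_le_one_left dist_nonneg hexp).trans_lt hp)
      rw [Function.iterate_succ_apply', Function.iterate_succ_apply']
      refine (hδ _ _ _ (hclose q hq) (hclose r hr)).trans ?_
      have hsum : ∑ l ∈ Finset.range (n - i), a (g^[l + 1] x) =
          ∑ l ∈ Finset.range (n - (i + 1)), a (g^[l + 1] x) + a (g^[n - i] x) := by
        rw [show n - i = (n - (i + 1)) + 1 by omega, Finset.sum_range_succ]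
      calc Real.exp (a (g^[n - i] x) + ε) * dist (g.symm^[i] q) (g.symm^[i] r)
          ≤ Real.exp (a (g^[n - i] x) + ε) * (Real.exp (∑ l ∈ Finset.range n, a (g^[l + 1] x) -
          ∑ l ∈ Finset.range (n - i), a (g^[l + 1] x) + ε * i) * dist q r) := by
            gcongr
            exact ih' q r hq hr
        _ = _ := by
            rw [← mul_assoc, ← Real.exp_add, hsum]
            congr 2
            push_cast
            ring
  intro q r hq hr
  refine (key i hi q r hq hr).trans ?_
  gcongr
  have h1 := hn (n - i) (by omega)
  rw [Nat.cast_sub (by omega)] at h1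
  linarith

/-- If the orbit of `x` returns infinitely often to the basin of an attracting fixed point `p` of
`g^{-m}`, then `p` lies on the orbit of `x`. -/
theorem exists_iterate_eq_of_frequently_mem {X : Type*} [MetricSpace X] (g : X ≃ X) {m : ℕ}
    (hm : 0 < m) {p x : X} {c D : ℝ} (hc0 : 0 ≤ c) (hc1 : c < 1) {B : Set X}
    (hmaps : MapsTo (g.symm^[m]) B B)
    (hcontr : ∀ q ∈ B, dist (g.symm^[m] q) p ≤ c * dist q p) (hB : ∀ q ∈ B, dist q p ≤ D)
    (hx : ∃ᶠ n in atTop, g^[n] x ∈ B) : ∃ r < m, g^[r] x = p := by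
  by_contra! hne
  have hiter : ∀ l : ℕ, ∀ q ∈ B, dist (g.symm^[m * l] q) p ≤ c ^ l * D := by
    intro l
    induction l with
    | zero => intro q hq; simpa using hB q hq
    | succ l ih =>
      intro q hq
      have hmem : g.symm^[m * l] q ∈ B := by
        rw [Function.iterate_mul]
        exact (hmaps.iterate l) hq
      rw [mul_add, mul_one, add_comm, Function.iterate_add_apply, pow_succ]
      calc _ ≤ c * dist (g.symm^[m * l] q) p := hcontr _ hmem
        _ ≤ c * (c ^ l * D) := by gcongr; exact ih q hq
        _ = _ := by ring
  have hlim : Tendsto (fun n : ℕ ↦ c ^ (n / m) * D) atTop (𝓝 0) := by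
    have h1 := ((tendsto_pow_atTop_nhds_zero_of_lt_one hc0 hc1).comp
      (Nat.tendsto_div_const_atTop hm.ne')).mul_const D
    simpa using h1
  -- A return at time `n`, pulled back by the largest multiple of `m` below or at `n`, lands on one
  -- of the finitely many points `g^r x`, `r < m`; these would all have positive distance to `p`.
  have hev : ∀ᶠ n : ℕ in atTop, ∀ r ∈ Finset.range m, c ^ (n / m) * D < dist (g^[r] x) p := by
    rw [eventually_all_finset]
    intro r hr
    exact hlim.eventually_lt_const (dist_pos.2 (hne r (Finset.mem_range.1 hr)))
  obtain ⟨n, hn, hn'⟩ := (hx.and_eventually hev).exists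
  have h1 := hiter (n / m) _ hn
  have h2 : g.symm^[m * (n / m)] (g^[n] x) = g^[n % m] x := by
    have h3 : g^[n] x = g^[m * (n / m)] (g^[n % m] x) := by
      rw [← Function.iterate_add_apply, Nat.div_add_mod]
    rw [h3]
    exact (Function.LeftInverse.iterate g.left_inv _) _
  rw [h2] at h1
  exact absurd h1 (not_le.2 (hn' _ (Finset.mem_range.2 (Nat.mod_lt _ hm))))

/-- A point of a compact metric space whose forward orbit is expanding on average belongs
to a repelling periodic orbit. -/
theorem exists_repelling_of_frequently_sum_le {X : Type*} [MetricSpace X] [CompactSpace X]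
    (g : X ≃ X) (a : X → ℝ)
    (ha : ∀ ε > 0, ∃ δ > 0, ∀ z q r, dist q z < δ → dist r z < δ →
      dist (g.symm q) (g.symm r) ≤ Real.exp (a z + ε) * dist q r)
    (x : X) {c : ℝ} (hc : 0 < c)
    (hx : ∃ᶠ n : ℕ in atTop, ∑ i ∈ Finset.range n, a (g^[i + 1] x) ≤ -c * n) :
    ∃ m > 0, ∃ p, g.symm^[m] p = p ∧ (∃ i < m, x = g.symm^[i] p) ∧
      ∃ V ∈ 𝓝 p, MapsTo (g.symm^[m]) V V ∧ ∃ b : ℝ, 0 < b ∧ b < 1 ∧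
        ∀ q ∈ V, ∀ r ∈ V, dist (g.symm^[m] q) (g.symm^[m] r) ≤ b * dist q r := by
  -- Backward averages at most `-c/2 = -2ε` leave the rate `-ε` after the local error `ε`.
  set ε := c / 4 with hεdef
  have hε : 0 < ε := by positivity
  obtain ⟨δ, hδ0, hδ⟩ := ha ε hε
  have hhyp := frequently_backward_average_le hc hx
  set T : ℕ → Prop := fun n ↦ ∀ j ≤ n, ∑ i ∈ Finset.range n, a (g^[i + 1] x) -
    ∑ i ∈ Finset.range j, a (g^[i + 1] x) ≤ -(2 * ε) * ((n : ℝ) - j) with hT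
  have hTf : ∃ᶠ n in atTop, T n := hhyp.mono fun n hn j hj ↦ (hn j hj).trans_eq (by
    rw [hεdef]; ring)
  obtain ⟨z, -, hz⟩ : ∃ z ∈ (univ : Set X), ∃ᶠ n in atTop, T n ∧ dist (g^[n] x) z < δ / 8 := by
    by_contra hcon
    have : NeBot (atTop ⊓ 𝓟 {n | T n}) := frequently_mem_iff_neBot.1 hTf
    obtain ⟨z, hz⟩ := exists_clusterPt_of_compactSpace
      (map (fun n ↦ g^[n] x) (atTop ⊓ 𝓟 {n | T n}))
    refine hcon ⟨z, mem_univ _, ?_⟩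
    have h1 : ∃ᶠ y in map (fun n ↦ g^[n] x) (atTop ⊓ 𝓟 {n | T n}), dist y z < δ / 8 :=
      clusterPt_iff_frequently.1 hz _ (Metric.ball_mem_nhds z (by positivity))
    rw [frequently_map, frequently_inf_principal] at h1
    exact h1
  -- A gap of more than `N` between the two times makes the contraction factor `e^(-εm)` at most
  -- `1/8`.
  obtain ⟨N, hN⟩ := exists_nat_gt (Real.log 8 / ε)
  obtain ⟨n₀, hn₀T, hn₀⟩ := hz.exists
  obtain ⟨n₁, hn₁, hn₁T, hn₁z⟩ := (frequently_atTop.1 hz) (n₀ + N + 1)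
  obtain ⟨m, rfl⟩ : ∃ m, n₁ = n₀ + m := ⟨n₁ - n₀, by omega⟩
  have hm : 0 < m := by omega
  set y := g^[n₀ + m] x with hy
  set b := Real.exp (-ε * m) with hb
  have hb8 : b ≤ 1 / 8 := by
    have h1 : Real.log 8 < N * ε := by rwa [div_lt_iff₀ hε] at hN
    have h2 : (N : ℝ) * ε ≤ m * ε := by
      gcongr; omega
    calc b ≤ Real.exp (-Real.log 8) := by rw [hb]; gcongr; linarith
      _ = 1 / 8 := by rw [Real.exp_neg, Real.exp_log (by norm_num)]; norm_num
  have hb0 : 0 < b := Real.exp_pos _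
  set B := Metric.closedBall y (δ / 2) with hBdef
  have hBδ : ∀ q ∈ B, dist q y < δ := fun q hq ↦
    (Metric.mem_closedBall.1 hq).trans_lt (by linarith)
  have hcontr : ∀ q ∈ B, ∀ r ∈ B, dist (g.symm^[m] q) (g.symm^[m] r) ≤ b * dist q r :=
    fun q hq r hr ↦ dist_symm_iterate_le g a hδ x hε.le hn₁T m (by omega) q r (hBδ q hq) (hBδ r hr)
  have hyB : y ∈ B := Metric.mem_closedBall_self (by positivity)
  have hyim : g.symm^[m] y = g^[n₀] x := by
    rw [hy, add_comm, Function.iterate_add_apply]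
    exact (Function.LeftInverse.iterate g.left_inv _) _
  have hdist : dist (g^[n₀] x) y < δ / 4 := by
    have := dist_triangle_right (g^[n₀] x) y z
    linarith
  have hclose : ∀ q ∈ B, dist (g.symm^[m] q) y ≤ δ / 16 + δ / 4 := by
    intro q hq
    have h1 := hcontr q hq y hyB
    rw [hyim] at h1
    have h2 : b * dist q y ≤ 1 / 8 * (δ / 2) :=
      mul_le_mul hb8 (Metric.mem_closedBall.1 hq) dist_nonneg (by norm_num)
    have := dist_triangle (g.symm^[m] q) (g^[n₀] x) y
    linarith
  have hmaps : MapsTo (g.symm^[m]) B B := fun q hq ↦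
    Metric.mem_closedBall.2 ((hclose q hq).trans (by linarith))
  obtain ⟨p, hpB, hpfix⟩ : ∃ p ∈ B, g.symm^[m] p = p := by
    have hcw : ContractingWith ⟨b, hb0.le⟩ (hmaps.restrict (g.symm^[m]) B B) := by
      refine ⟨?_, ?_⟩
      · exact NNReal.coe_lt_coe.1 (lt_of_le_of_lt hb8 (by norm_num) : b < ((1 : NNReal) : ℝ))
      · exact LipschitzWith.of_dist_le_mul fun q r ↦ hcontr q q.2 r r.2
    obtain ⟨p, hp, hpf, -⟩ := ContractingWith.exists_fixedPoint'
      (Metric.isClosed_closedBall.isComplete) hmaps hcw hyB (edist_ne_top _ _)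
    exact ⟨p, hp, hpf⟩
  -- The image of `B` lies at distance at most `5δ/16 < δ/2` from `y`, so the fixed point is
  -- interior to `B`.
  have hpV : B ∈ 𝓝 p := by
    have : dist p y < δ / 2 := by
      have := hclose p hpB
      rw [hpfix] at this
      linarith
    exact mem_of_superset (Metric.isOpen_ball.mem_nhds (Metric.mem_ball.2 this))
      Metric.ball_subset_closedBall
  obtain ⟨r, hr, hrp⟩ := exists_iterate_eq_of_frequently_mem g hm hb0.le
    (hb8.trans_lt (by norm_num)) hmaps (p := p) (x := x) (D := δ)
    (fun q hq ↦ by simpa only [hpfix] using hcontr q hq p hpB)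
    (fun q hq ↦ by
      have h1 := dist_triangle_right q p y
      have h2 := Metric.mem_closedBall.1 hq
      have h3 := Metric.mem_closedBall.1 hpB
      linarith)
    (hz.mono fun n hn ↦ by
      refine Metric.mem_closedBall.2 ?_
      have := dist_triangle_right (g^[n] x) y z
      linarith [hn.2])
  refine ⟨m, hm, p, hpfix, ⟨r, hr, ?_⟩, B, hpV, hmaps, b, hb0, hb8.trans_lt (by norm_num), hcontr⟩
  rw [← hrp]
  exact ((Function.LeftInverse.iterate g.left_inv r) x).symm

/-! ### Continuity of the Riemannian norm of the derivative. -/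

theorem continuous_norm_comp_comp {E₁ E₂ E₃ E₄ : Type*} [NormedAddCommGroup E₁] [NormedSpace ℝ E₁]
    [NormedAddCommGroup E₂] [NormedSpace ℝ E₂] [NormedAddCommGroup E₃] [NormedSpace ℝ E₃]
    [NormedAddCommGroup E₄] [NormedSpace ℝ E₄] (S : E₃ →L[ℝ] E₄) (T : E₁ →L[ℝ] E₂) :
    Continuous fun A : E₂ →L[ℝ] E₃ ↦ ‖S ∘L A ∘L T‖ := by
  fun_prop

section

variable {E : Type*} [NormedAddCommGroup E] [NormedSpace ℝ E]
  {H : Type*} [TopologicalSpace H] {I : ModelWithCorners ℝ E H}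
  {M : Type*} [TopologicalSpace M] [ChartedSpace H M] [IsManifold I 1 M]

variable (I) in
/-- The derivative of a map, read in the trivializations of the tangent bundle at `x₀` and `h x₀`,
as a map between the tangent spaces at `x₀` and `h x₀`. -/
noncomputable def mfderivTransported (h : M → M) (x₀ y : M) :
    TangentSpace I x₀ →L[ℝ] TangentSpace I (h x₀) :=
  (trivializationAt E (TangentSpace I) (h x₀)).symmL ℝ (h x₀) ∘L
    (inTangentCoordinates I I id h (fun z ↦ mfderiv I I h z) x₀ y) ∘L
      (trivializationAt E (TangentSpace I) x₀).continuousLinearMapAt ℝ x₀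

theorem mfderivTransported_eq (h : M → M) (x₀ y : M) :
    mfderivTransported I h x₀ y =
      ((trivializationAt E (TangentSpace I) (h x₀)).symmL ℝ (h x₀) ∘L
        (trivializationAt E (TangentSpace I) (h x₀)).continuousLinearMapAt ℝ (h y)) ∘L
      (mfderiv I I h y) ∘L
      ((trivializationAt E (TangentSpace I) x₀).symmL ℝ y ∘L
        (trivializationAt E (TangentSpace I) x₀).continuousLinearMapAt ℝ x₀) := rfl

theorem symmL_comp_continuousLinearMapAt {x₀ y z : M}
    (hy : y ∈ (trivializationAt E (TangentSpace I) x₀).baseSet)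
    (v : TangentSpace I z) (hz : z ∈ (trivializationAt E (TangentSpace I) x₀).baseSet) :
    ((trivializationAt E (TangentSpace I) x₀).symmL ℝ z)
      ((trivializationAt E (TangentSpace I) x₀).continuousLinearMapAt ℝ y
        ((trivializationAt E (TangentSpace I) x₀).symmL ℝ y
          ((trivializationAt E (TangentSpace I) x₀).continuousLinearMapAt ℝ z v))) = v := by
  rw [Trivialization.continuousLinearMapAt_symmL _ hy,
    Trivialization.symmL_continuousLinearMapAt _ hz]

theorem mfderiv_eq_mfderivTransported (h : M → M) {x₀ y : M}
    (hy : y ∈ (trivializationAt E (TangentSpace I) x₀).baseSet)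
    (hhy : h y ∈ (trivializationAt E (TangentSpace I) (h x₀)).baseSet) :
    mfderiv I I h y =
      ((trivializationAt E (TangentSpace I) (h x₀)).symmL ℝ (h y) ∘L
        (trivializationAt E (TangentSpace I) (h x₀)).continuousLinearMapAt ℝ (h x₀)) ∘L
      mfderivTransported I h x₀ y ∘L
      ((trivializationAt E (TangentSpace I) x₀).symmL ℝ x₀ ∘L
        (trivializationAt E (TangentSpace I) x₀).continuousLinearMapAt ℝ y) := by
  ext v
  rw [mfderivTransported_eq]
  simp only [ContinuousLinearMap.comp_apply]
  have hx₀ : x₀ ∈ (trivializationAt E (TangentSpace I) x₀).baseSet :=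
    FiberBundle.mem_baseSet_trivializationAt' x₀
  have hhx₀ : h x₀ ∈ (trivializationAt E (TangentSpace I) (h x₀)).baseSet :=
    FiberBundle.mem_baseSet_trivializationAt' (h x₀)
  rw [symmL_comp_continuousLinearMapAt hx₀ v hy, symmL_comp_continuousLinearMapAt hhx₀ _ hhy]

variable [RiemannianBundle (fun (x : M) ↦ TangentSpace I x)]
  [IsContinuousRiemannianBundle E (fun (x : M) ↦ TangentSpace I x)]

/-- The norm of the derivative of a `C^1` map of a Riemannian manifold is continuous. -/
theorem continuous_norm_mfderiv {h : M → M} (hh : ContMDiff I I 1 h) :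
    Continuous (fun y ↦ ‖mfderiv I I h y‖) := by
  rw [continuous_iff_continuousAt]
  intro x₀
  have hcont : ContinuousAt (fun y ↦ ‖mfderivTransported I h x₀ y‖) x₀ := by
    have h1 : ContinuousAt (inTangentCoordinates I I id h (fun z ↦ mfderiv I I h z) x₀) x₀ :=
      (ContMDiffAt.mfderiv_const (m := 0) (hh x₀) (by simp)).continuousAt
    exact (continuous_norm_comp_comp
      (E₁ := TangentSpace I x₀) (E₂ := E) (E₃ := E) (E₄ := TangentSpace I (h x₀))
      ((trivializationAt E (TangentSpace I) (h x₀)).symmL ℝ (h x₀))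
      ((trivializationAt E (TangentSpace I) x₀).continuousLinearMapAt ℝ
        x₀)).continuousAt.comp h1
  have hself : mfderivTransported I h x₀ x₀ = mfderiv I I h x₀ := by
    ext v
    rw [mfderivTransported_eq]
    simp only [ContinuousLinearMap.comp_apply]
    rw [Trivialization.symmL_continuousLinearMapAt _ (FiberBundle.mem_baseSet_trivializationAt' x₀),
      Trivialization.symmL_continuousLinearMapAt _
        (FiberBundle.mem_baseSet_trivializationAt' (h x₀))]
  -- The norms live on varying fibres. Near `x₀` the trivializations distort them by factors below
  -- any `r > 1`, so the true and the transported norms agree up to `r²`.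
  have hup : ∀ r : ℝ, 1 < r → ∀ᶠ y in 𝓝 x₀,
      ‖mfderiv I I h y‖ ≤ r * ‖mfderivTransported I h x₀ y‖ * r ∧
      ‖mfderivTransported I h x₀ y‖ ≤ r * ‖mfderiv I I h y‖ * r := by
    intro r hr
    have hc : ContinuousAt h x₀ := hh.continuous.continuousAt
    filter_upwards [
      eventually_norm_symmL_trivializationAt_self_comp_lt E (fun x : M ↦ TangentSpace I x) x₀ hr,
      eventually_norm_symmL_trivializationAt_comp_self_lt E (fun x : M ↦ TangentSpace I x) x₀ hr,
      hc.eventually (eventually_norm_symmL_trivializationAt_self_comp_lt E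
        (fun x : M ↦ TangentSpace I x) (h x₀) hr),
      hc.eventually (eventually_norm_symmL_trivializationAt_comp_self_lt E
        (fun x : M ↦ TangentSpace I x) (h x₀) hr),
      (trivializationAt E (TangentSpace I) x₀).open_baseSet.mem_nhds
        (FiberBundle.mem_baseSet_trivializationAt' x₀),
      hc.eventually ((trivializationAt E (TangentSpace I) (h x₀)).open_baseSet.mem_nhds
        (FiberBundle.mem_baseSet_trivializationAt' (h x₀)))] with y h1 h2 h3 h4 h5 h6
    have hr0 : 0 ≤ r := by linarith
    constructor
    · conv_lhs => rw [mfderiv_eq_mfderivTransported h h5 h6]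
      refine (ContinuousLinearMap.opNorm_comp_le _ _).trans ?_
      rw [mul_assoc]
      refine mul_le_mul h4.le ?_ (norm_nonneg _) hr0
      refine (ContinuousLinearMap.opNorm_comp_le _ _).trans ?_
      gcongr
    · conv_lhs => rw [mfderivTransported_eq]
      refine (ContinuousLinearMap.opNorm_comp_le _ _).trans ?_
      rw [mul_assoc]
      refine mul_le_mul h3.le ?_ (norm_nonneg _) hr0
      refine (ContinuousLinearMap.opNorm_comp_le _ _).trans ?_
      gcongr
  have hlim : ∀ A : ℝ, Tendsto (fun r : ℝ ↦ r * A * r) (𝓝[>] 1) (𝓝 A) := by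
    intro A
    have : Tendsto (fun r : ℝ ↦ r * A * r) (𝓝 1) (𝓝 (1 * A * 1)) :=
      Continuous.tendsto (by fun_prop) 1
    simpa using this.mono_left nhdsWithin_le_nhds
  set A := ‖mfderiv I I h x₀‖ with hA
  rw [ContinuousAt, hself] at hcont
  rw [ContinuousAt, ← hA, tendsto_order]
  constructor
  · intro a ha
    obtain ⟨r, hr, hr1⟩ := (((hlim a).eventually_lt_const ha).and self_mem_nhdsWithin).exists
    filter_upwards [hup r hr1, hcont.eventually_const_lt hr] with y hy hy'
    by_contra! hle
    have hr0 : (0 : ℝ) ≤ r := by exact zero_le_one.trans (le_of_lt hr1)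
    have : r * ‖mfderiv I I h y‖ * r ≤ r * a * r := by gcongr
    linarith [hy.2]
  · intro a ha
    obtain ⟨r, hr, hr1⟩ := (((hlim A).eventually_lt_const ha).and self_mem_nhdsWithin).exists
    have h1 : Tendsto (fun y ↦ r * ‖mfderivTransported I h x₀ y‖ * r) (𝓝 x₀) (𝓝 (r * A * r)) :=
      (hcont.const_mul r).mul_const r
    filter_upwards [hup r hr1, h1.eventually_lt_const hr] with y hy hy'
    exact hy.1.trans_lt hy'

end

/-! ### From derivative bounds to Lipschitz bounds. -/

section

variable {E : Type*} [NormedAddCommGroup E] [NormedSpace ℝ E]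
  {H : Type*} [TopologicalSpace H] {I : ModelWithCorners ℝ E H}
  {M : Type*} [MetricSpace M] [ChartedSpace H M]
  [RiemannianBundle (fun (x : M) ↦ TangentSpace I x)]

open MeasureTheory in
theorem pathELength_comp_le {h : M → M} (hh : ContMDiff I I 1 h) {γ : ℝ → M}
    (hγ : ContMDiffOn 𝓘(ℝ, ℝ) I 1 γ (Icc 0 1)) {C : NNReal}
    (hC : ∀ t ∈ Icc (0 : ℝ) 1, ‖mfderiv I I h (γ t)‖ ≤ C) :
    pathELength I (h ∘ γ) 0 1 ≤ C * pathELength I γ 0 1 := by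
  rw [pathELength_eq_lintegral_mfderivWithin_Icc, pathELength_eq_lintegral_mfderivWithin_Icc,
    ← lintegral_const_mul' _ _ ENNReal.coe_ne_top]
  apply setLIntegral_mono' measurableSet_Icc (fun t ht ↦ ?_)
  have h1 : mfderivWithin 𝓘(ℝ, ℝ) I (h ∘ γ) (Icc 0 1) t =
      (mfderiv I I h (γ t)) ∘L (mfderivWithin 𝓘(ℝ, ℝ) I γ (Icc 0 1) t) := by
    apply mfderiv_comp_mfderivWithin
    · exact (hh.mdifferentiable one_ne_zero) _
    · exact (hγ.mdifferentiableOn one_ne_zero) _ ht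
    · rw [uniqueMDiffWithinAt_iff_uniqueDiffWithinAt]
      exact uniqueDiffOn_Icc zero_lt_one _ ht
  have h2 : mfderivWithin 𝓘(ℝ, ℝ) I (h ∘ γ) (Icc 0 1) t 1 =
      (mfderiv I I h (γ t)) (mfderivWithin 𝓘(ℝ, ℝ) I γ (Icc 0 1) t 1) := congr($h1 1)
  rw [h2]
  apply (ContinuousLinearMap.le_opENorm _ _).trans
  gcongr
  rw [← ofReal_norm]
  exact ENNReal.ofReal_le_of_le_toReal (hC t ht)

variable [IsRiemannianManifold I M]

/-- A `C^1` map of a Riemannian manifold whose derivative is bounded by `C` on a ball is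
`C`-Lipschitz on the ball with a third of the radius. -/
theorem dist_le_of_norm_mfderiv_le {h : M → M} (hh : ContMDiff I I 1 h) {z : M} {δ C : ℝ}
    (hC : ∀ y, dist y z < 3 * δ → ‖mfderiv I I h y‖ ≤ C) {q r : M} (hq : dist q z < δ)
    (hr : dist r z < δ) : dist (h q) (h r) ≤ C * dist q r := by
  have hδ : 0 < δ := dist_nonneg.trans_lt hq
  have hC0 : 0 ≤ C := (ContinuousLinearMap.opNorm_nonneg _).trans (hC z (by simpa using hδ))
  lift C to NNReal using hC0
  have hqr : dist q r < 2 * δ := by linarith [dist_triangle_right q r z]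
  -- The distance is an infimum of lengths, so curves exist only with length below some `R > dist q
  -- r`; then `R` decreases to `dist q r`.
  suffices key : ∀ R : ℝ, dist q r < R → R < 2 * δ → dist (h q) (h r) ≤ C * R by
    refine ge_of_tendsto (x := 𝓝[>] (dist q r)) (f := fun R : ℝ ↦ (C : ℝ) * R) ?_ ?_
    · exact (Continuous.tendsto (by fun_prop) _).mono_left nhdsWithin_le_nhds
    · filter_upwards [Ioo_mem_nhdsGT hqr] with R hR using key R hR.1 hR.2
  intro R hR hRδ
  have hR0 : 0 ≤ R := dist_nonneg.trans hR.le
  have h1 : riemannianEDist I q r < ENNReal.ofReal R := by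
    rw [← IsRiemannianManifold.out (I := I) q r, edist_dist]
    exact (ENNReal.ofReal_lt_ofReal_iff_of_nonneg dist_nonneg).2 hR
  obtain ⟨γ, h0, h1, hγ, hlen⟩ := exists_lt_of_riemannianEDist_lt h1
  -- The curve starts within `δ` of `z` and has length below `2δ`, hence the ball of radius `3δ`.
  have hin : ∀ t ∈ Icc (0 : ℝ) 1, dist (γ t) z < 3 * δ := by
    intro t ht
    have h2 : edist q (γ t) < ENNReal.ofReal R := by
      rw [IsRiemannianManifold.out (I := I) q (γ t)]
      refine (riemannianEDist_le_pathELength (hγ.mono (Icc_subset_Icc le_rfl ht.2)) h0 rfl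
        ht.1).trans_lt (lt_of_le_of_lt ?_ hlen)
      exact pathELength_mono le_rfl ht.2
    rw [edist_dist] at h2
    have h3 : dist q (γ t) < R := (ENNReal.ofReal_lt_ofReal_iff_of_nonneg dist_nonneg).1 h2
    have := dist_triangle_left (γ t) z q
    linarith
  have h2 : edist (h q) (h r) ≤ C * ENNReal.ofReal R := by
    rw [IsRiemannianManifold.out (I := I) (h q) (h r)]
    refine (riemannianEDist_le_pathELength (γ := h ∘ γ) (hh.comp_contMDiffOn hγ) (by simp [h0])
      (by simp [h1]) zero_le_one).trans ?_
    refine (pathELength_comp_le hh hγ fun t ht ↦ hC _ (hin t ht)).trans ?_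
    gcongr
  rw [edist_dist, ← ENNReal.ofReal_coe_nnreal, ← ENNReal.ofReal_mul (NNReal.coe_nonneg C)] at h2
  exact (ENNReal.ofReal_le_ofReal_iff (by positivity)).1 h2

variable [CompactSpace M] [IsManifold I 1 M]
  [IsContinuousRiemannianBundle E (fun (x : M) ↦ TangentSpace I x)]

/-- On a compact Riemannian manifold, a `C^1` map with nowhere vanishing derivative is locally
Lipschitz with the norm of its derivative as constant, up to a factor `e^ε`, uniformly. -/
theorem exists_dist_le_exp_log_norm_mfderiv {h : M → M} (hh : ContMDiff I I 1 h)
    (hne : ∀ y, 0 < ‖mfderiv I I h y‖) {ε : ℝ} (hε : 0 < ε) :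
    ∃ δ > 0, ∀ z q r, dist q z < δ → dist r z < δ →
      dist (h q) (h r) ≤ Real.exp (Real.log ‖mfderiv I I h z‖ + ε) * dist q r := by
  have hcont : Continuous fun y ↦ Real.log ‖mfderiv I I h y‖ :=
    (continuous_norm_mfderiv hh).log fun y ↦ (hne y).ne'
  have hu := CompactSpace.uniformContinuous_of_continuous hcont
  obtain ⟨δ, hδ, H⟩ := Metric.uniformContinuous_iff.1 hu ε hε
  refine ⟨δ / 3, by positivity, fun z q r hq hr ↦ dist_le_of_norm_mfderiv_le hh ?_ hq hr⟩
  intro y hy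
  have h1 := H (show dist y z < δ by linarith)
  rw [Real.dist_eq] at h1
  rw [← Real.log_le_iff_le_exp (hne y)]
  linarith [(abs_lt.1 h1).2]

/-- A `C^1` map of a compact Riemannian manifold is locally Lipschitz, with uniform constants. -/
theorem exists_forall_dist_le {h : M → M} (hh : ContMDiff I I 1 h) :
    ∃ C > 0, ∃ δ > 0, ∀ q r, dist q r < δ → dist (h q) (h r) ≤ C * dist q r := by
  obtain ⟨C, hC⟩ := (isCompact_range (continuous_norm_mfderiv hh)).bddAbove
  refine ⟨|C| + 1, by positivity, 1, one_pos, fun q r hqr ↦ ?_⟩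
  refine dist_le_of_norm_mfderiv_le hh (z := q) (δ := 1) (fun y _ ↦ ?_) (by simp)
    (by rwa [dist_comm])
  exact (hC ⟨y, rfl⟩).trans ((le_abs_self C).trans (by linarith))

end

/-! ### From Lipschitz bounds at a fixed point to derivative bounds. -/

/-- A tangent vector is a limit of rescaled increments `c n • d n` inside `s`, and `A v` is the
limit of the correspondingly rescaled increments of `f`. At boundary points only such directions can
be tested. -/
theorem HasFDerivWithinAt.norm_apply_le_of_mem_tangentConeAt {E F : Type*}
    [NormedAddCommGroup E] [NormedSpace ℝ E] [NormedAddCommGroup F] [NormedSpace ℝ F]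
    {f : E → F} {A : E →L[ℝ] F} {s : Set E} {x : E} (hf : HasFDerivWithinAt f A s x) {C : ℝ}
    (hC : ∀ᶠ w in 𝓝[s] x, ‖f w - f x‖ ≤ C * ‖w - x‖) {v : E} (hv : v ∈ tangentConeAt ℝ s x) :
    ‖A v‖ ≤ C * ‖v‖ := by
  obtain ⟨ι, l, hl, c, d, hd0, hds, hcd⟩ := exists_fun_of_mem_tangentConeAt hv
  have hlim := (hf.lim hd0 hds hcd).norm
  have harg : Tendsto (fun n ↦ x + d n) l (𝓝[s] x) := by
    rw [tendsto_nhdsWithin_iff]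
    exact ⟨by simpa using hd0.const_add x, hds⟩
  refine le_of_tendsto_of_tendsto hlim (hcd.norm.const_mul C) ?_
  filter_upwards [harg.eventually hC] with n hn
  rw [norm_smul, norm_smul]
  rw [add_sub_cancel_left] at hn
  calc ‖c n‖ * ‖f (x + d n) - f x‖ ≤ ‖c n‖ * (C * ‖d n‖) := by gcongr
    _ = C * (‖c n‖ * ‖d n‖) := by ring

section

variable {E : Type*} [NormedAddCommGroup E] [NormedSpace ℝ E]
  {H : Type*} [TopologicalSpace H] {I : ModelWithCorners ℝ E H}
  {M : Type*} [MetricSpace M] [ChartedSpace H M]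
  [RiemannianBundle (fun (x : M) ↦ TangentSpace I x)]

/-- Linear maps between tangent spaces which coincide in the model space have the same norm. -/
theorem norm_eq_of_apply_eq {a b b' : M} (hb : b = b')
    (A : TangentSpace I a →L[ℝ] TangentSpace I b) (B : TangentSpace I a →L[ℝ] TangentSpace I b')
    (h : ∀ v : E, (A v : E) = (B v : E)) : ‖A‖ = ‖B‖ := by
  subst hb
  congr 1
  ext v
  exact h v

variable [IsManifold I 1 M] [IsRiemannianManifold I M]
  [IsContinuousRiemannianBundle E (fun (x : M) ↦ TangentSpace I x)]

open MeasureTheory in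
variable (I) in
/-- The extended chart at `x` is Lipschitz at `x`. -/
theorem exists_norm_extChartAt_sub_le (x : M) :
    ∃ C > 0, ∀ᶠ y in 𝓝 x, ‖extChartAt I x y - extChartAt I x x‖ ≤ C * dist y x := by
  obtain ⟨C, hC0, hC⟩ := eventually_norm_trivializationAt_lt E (fun x : M ↦ TangentSpace I x) x
  obtain ⟨δ, hδ, hball⟩ := Metric.eventually_nhds_iff.1 (hC.and (chart_source_mem_nhds H x))
  lift C to NNReal using hC0.le
  refine ⟨C, hC0, Metric.eventually_nhds_iff.2 ⟨δ, hδ, fun y hy ↦ ?_⟩⟩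
  suffices key : ∀ R : ℝ, dist y x < R → R < δ →
      ‖extChartAt I x y - extChartAt I x x‖ ≤ C * R by
    refine ge_of_tendsto (x := 𝓝[>] (dist y x)) (f := fun R : ℝ ↦ (C : ℝ) * R) ?_ ?_
    · exact (Continuous.tendsto (by fun_prop) _).mono_left nhdsWithin_le_nhds
    · filter_upwards [Ioo_mem_nhdsGT hy] with R hR using key R hR.1 hR.2
  intro R hR hRδ
  have hR0 : 0 ≤ R := dist_nonneg.trans hR.le
  have h1 : riemannianEDist I x y < ENNReal.ofReal R := by
    rw [← IsRiemannianManifold.out (I := I) x y, edist_dist, dist_comm]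
    exact (ENNReal.ofReal_lt_ofReal_iff_of_nonneg dist_nonneg).2 hR
  obtain ⟨γ, h0, h1, hγ, hlen⟩ := exists_lt_of_riemannianEDist_lt h1
  have hin : ∀ t ∈ Icc (0 : ℝ) 1, dist (γ t) x < δ := by
    intro t ht
    have h2 : edist x (γ t) < ENNReal.ofReal R := by
      rw [IsRiemannianManifold.out (I := I) x (γ t)]
      refine (riemannianEDist_le_pathELength (hγ.mono (Icc_subset_Icc le_rfl ht.2)) h0 rfl
        ht.1).trans_lt (lt_of_le_of_lt ?_ hlen)
      exact pathELength_mono le_rfl ht.2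
    rw [edist_dist, dist_comm] at h2
    exact ((ENNReal.ofReal_lt_ofReal_iff_of_nonneg dist_nonneg).1 h2).trans hRδ
  have hsm : ContDiffOn ℝ 1 (extChartAt I x ∘ γ) (Icc 0 1) := by
    rw [← contMDiffOn_iff_contDiffOn]
    exact contMDiffOn_extChartAt.comp (I' := I) (t := (chartAt H x).source) hγ
      fun t ht ↦ (hball (hin t ht)).2
  have h2 : ‖extChartAt I x y - extChartAt I x x‖ₑ ≤ C * ENNReal.ofReal R := by
    calc
      ‖extChartAt I x y - extChartAt I x x‖ₑ
        = ‖(extChartAt I x ∘ γ) 1 - (extChartAt I x ∘ γ) 0‖ₑ := by simp [h0, h1]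
    _ ≤ ∫⁻ t in Icc 0 1, ‖derivWithin (extChartAt I x ∘ γ) (Icc 0 1) t‖ₑ :=
      enorm_sub_le_lintegral_derivWithin_Icc_of_contDiffOn_Icc hsm zero_le_one
    _ ≤ ∫⁻ t in Icc 0 1, C * ‖mfderivWithin 𝓘(ℝ, ℝ) I γ (Icc 0 1) t 1‖ₑ := by
      apply setLIntegral_mono' measurableSet_Icc (fun t ht ↦ ?_)
      have h3 : mfderivWithin 𝓘(ℝ, ℝ) 𝓘(ℝ, E) (extChartAt I x ∘ γ) (Icc 0 1) t =
          (mfderiv I 𝓘(ℝ, E) (extChartAt I x) (γ t)) ∘L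
            (mfderivWithin 𝓘(ℝ, ℝ) I γ (Icc 0 1) t) := by
        apply mfderiv_comp_mfderivWithin
        · exact mdifferentiableAt_extChartAt (hball (hin t ht)).2
        · exact (hγ.mdifferentiableOn one_ne_zero) _ ht
        · rw [uniqueMDiffWithinAt_iff_uniqueDiffWithinAt]
          exact uniqueDiffOn_Icc zero_lt_one _ ht
      rw [← TangentBundle.continuousLinearMapAt_trivializationAt (hball (hin t ht)).2] at h3
      have h4 : derivWithin (extChartAt I x ∘ γ) (Icc 0 1) t =
          (trivializationAt E (TangentSpace I) x).continuousLinearMapAt ℝ (γ t)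
            (mfderivWithin 𝓘(ℝ, ℝ) I γ (Icc 0 1) t 1) := by
        rw [← fderivWithin_derivWithin, ← mfderivWithin_eq_fderivWithin]
        exact congr($h3 1)
      rw [h4]
      apply (ContinuousLinearMap.le_opENorm _ _).trans
      gcongr
      rw [← ofReal_norm]
      exact ENNReal.ofReal_le_of_le_toReal (hball (hin t ht)).1.le
    _ = C * pathELength I γ 0 1 := by
      rw [lintegral_const_mul' _ _ ENNReal.coe_ne_top,
          pathELength_eq_lintegral_mfderivWithin_Icc]
    _ ≤ C * ENNReal.ofReal R := by gcongr
  rw [← ofReal_norm, ← ENNReal.ofReal_coe_nnreal, ← ENNReal.ofReal_mul (NNReal.coe_nonneg C)] at h2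
  exact (ENNReal.ofReal_le_ofReal_iff (by positivity)).1 h2

variable (I) in
/-- The inverse of the extended chart at `x` is Lipschitz at `x`. -/
theorem exists_dist_le_norm_extChartAt_sub (x : M) :
    ∃ C > 0, ∀ᶠ y in 𝓝 x, dist y x ≤ C * ‖extChartAt I x y - extChartAt I x x‖ := by
  obtain ⟨C, hC0, hC⟩ := eventually_riemannianEDist_le_edist_extChartAt I x
  refine ⟨C, hC0, ?_⟩
  filter_upwards [hC] with y hy
  rw [← IsRiemannianManifold.out (I := I) x y, edist_dist, edist_dist,
    ← ENNReal.ofReal_coe_nnreal, ← ENNReal.ofReal_mul (NNReal.coe_nonneg C),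
    ENNReal.ofReal_le_ofReal_iff (by positivity)] at hy
  rwa [dist_comm, ← dist_eq_norm, dist_comm (extChartAt I x y)]

variable (I) in
/-- The derivative at a fixed point of a map which is `K`-Lipschitz there is bounded by a multiple
of `K` on tangent directions, in the model space. -/
theorem exists_norm_mfderiv_apply_le (x : M) :
    ∃ C > 0, ∀ (h : M → M) (K : ℝ), MDifferentiableAt I I h x → h x = x → 0 ≤ K →
      (∀ᶠ y in 𝓝 x, dist (h y) x ≤ K * dist y x) →
      ∀ v ∈ tangentConeAt ℝ (range I) (extChartAt I x x),
        ‖(show E →L[ℝ] E from mfderiv I I h x) v‖ ≤ C * K * ‖v‖ := by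
  obtain ⟨C₁, hC₁0, hC₁⟩ := exists_norm_extChartAt_sub_le I x
  obtain ⟨C₂, hC₂0, hC₂⟩ := exists_dist_le_norm_extChartAt_sub I x
  refine ⟨C₁ * C₂, by positivity, fun h K hh hx hK hle v hv ↦ ?_⟩
  have hder : HasFDerivWithinAt (writtenInExtChartAt I I x h)
      (show E →L[ℝ] E from mfderiv I I h x) (range I) (extChartAt I x x) := hh.hasMFDerivAt.2
  refine hder.norm_apply_le_of_mem_tangentConeAt ?_ hv
  have hsymm : Tendsto (extChartAt I x).symm (𝓝[range I] (extChartAt I x x)) (𝓝 x) := by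
    have := (continuousAt_extChartAt_symm (I := I) x).tendsto
    rw [extChartAt_to_inv] at this
    exact this.mono_left nhdsWithin_le_nhds
  have hcont : Tendsto h (𝓝 x) (𝓝 x) := by
    simpa [hx] using hh.continuousAt.tendsto
  filter_upwards [hsymm.eventually (hcont.eventually hC₁), hsymm.eventually hC₂,
    hsymm.eventually hle, extChartAt_target_mem_nhdsWithin (I := I) x] with w h1 h2 h3 h4
  rw [(extChartAt I x).right_inv h4] at h2
  have h5 : ‖writtenInExtChartAt I I x h w - writtenInExtChartAt I I x h (extChartAt I x x)‖ =
      ‖extChartAt I x (h ((extChartAt I x).symm w)) - extChartAt I x x‖ := by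
    simp only [writtenInExtChartAt, Function.comp_apply, extChartAt_to_inv, hx]
  rw [h5]
  calc _ ≤ C₁ * dist (h ((extChartAt I x).symm w)) x := h1
    _ ≤ C₁ * (K * (C₂ * ‖w - extChartAt I x x‖)) := by
      gcongr
      exact h3.trans (by gcongr)
    _ = _ := by ring

/-- If `C^1` maps fixing `x` have Lipschitz constants at `x` converging to zero, then the norms of
their derivatives at `x` are eventually smaller than `1`. -/
theorem eventually_norm_mfderiv_lt_one [FiniteDimensional ℝ E] {x : M} {h : ℕ → M → M} {K : ℕ → ℝ}
    (hh : ∀ n, MDifferentiableAt I I (h n) x) (hx : ∀ n, h n x = x) (hK : ∀ n, 0 ≤ K n)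
    (hK0 : Tendsto K atTop (𝓝 0)) (hle : ∀ n, ∀ᶠ y in 𝓝 x, dist (h n y) x ≤ K n * dist y x) :
    ∀ᶠ n in atTop, ‖mfderiv I I (h n) x‖ < 1 := by
  obtain ⟨C, hC0, hC⟩ := exists_norm_mfderiv_apply_le I x
  let A : ℕ → E →L[ℝ] E := fun n ↦ mfderiv I I (h n) x
  -- The directions along which the derivatives tend to zero form a subspace containing the tangent
  -- cone. The cone spans densely by unique differentiability of `range I`, and `W` is closed in
  -- finite dimension, so `W` is everything.
  let W : Submodule ℝ E :=
    { carrier := {v | Tendsto (fun n ↦ A n v) atTop (𝓝 0)}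
      add_mem' := fun {v w} hv hw ↦ by
        simpa only [mem_ofPred_eq, map_add, add_zero] using Tendsto.add hv hw
      zero_mem' := by simp
      smul_mem' := fun c v hv ↦ by
        simpa only [mem_ofPred_eq, map_smul, smul_zero] using Tendsto.const_smul hv c }
  have hcone : tangentConeAt ℝ (range I) (extChartAt I x x) ⊆ W := by
    intro v hv
    refine squeeze_zero_norm (fun n ↦ hC (h n) (K n) (hh n) (hx n) (hK n) (hle n) v hv) ?_
    simpa using (hK0.const_mul C).mul_const ‖v‖
  have hW : ∀ v : E, Tendsto (fun n ↦ A n v) atTop (𝓝 0) := by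
    have hdense : Dense (Submodule.span ℝ (tangentConeAt ℝ (range I) (extChartAt I x x)) : Set E) :=
      (I.uniqueDiffOn _ (mem_range_self _)).dense_tangentConeAt
    have hWtop : W = ⊤ := by
      rw [← top_le_iff, ← Submodule.dense_iff_topologicalClosure_eq_top.1 hdense]
      refine Submodule.topologicalClosure_minimal _ (Submodule.span_le.2 hcone) ?_
      exact Submodule.closed_of_finiteDimensional W
    intro v
    have : v ∈ W := hWtop ▸ Submodule.mem_top
    exact this
  -- The same maps, now measured in the Riemannian norm; smallness on a basis bounds the operator
  -- norm.
  let B : ℕ → TangentSpace I x →L[ℝ] TangentSpace I x := A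
  have : FiniteDimensional ℝ (TangentSpace I x) := inferInstanceAs (FiniteDimensional ℝ E)
  let b := Module.finBasis ℝ (TangentSpace I x)
  obtain ⟨D, hD0, hD⟩ := b.exists_opNorm_le (F := TangentSpace I x)
  have hsmall : ∀ᶠ n in atTop, ∀ i, ‖B n (b i)‖ ≤ 1 / (2 * D) := by
    rw [eventually_all]
    intro i
    have h1 : Tendsto (fun n ↦ B n (b i)) atTop (𝓝 (0 : TangentSpace I x)) := hW (b i)
    have h2 := tendsto_zero_iff_norm_tendsto_zero.1 h1
    exact h2.eventually_le_const (by positivity)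
  filter_upwards [hsmall] with n hn
  have h1 : ‖mfderiv I I (h n) x‖ = ‖B n‖ := norm_eq_of_apply_eq (hx n) _ _ fun v ↦ rfl
  rw [h1]
  refine (hD (by positivity) hn).trans_lt ?_
  have : D * (1 / (2 * D)) = 1 / 2 := by field_simp
  rw [this]
  norm_num

end

/-! ### The two implications. -/

section

variable {E : Type*} [NormedAddCommGroup E] [NormedSpace ℝ E]
  {H : Type*} [TopologicalSpace H] {I : ModelWithCorners ℝ E H}
  {M : Type*} [MetricSpace M] [ChartedSpace H M]

theorem mfderiv_comp_mfderiv_apply_of_leftInverse {F G : M → M} {y : M}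
    (hF : MDifferentiableAt I I F y) (hG : MDifferentiableAt I I G (F y))
    (h : Function.LeftInverse G F) (v : E) :
    (mfderiv I I G (F y) (mfderiv I I F y v) : E) = v := by
  have h1 := mfderiv_comp y hG hF
  rw [h.id, mfderiv_id] at h1
  exact (congr($h1 v)).symm

variable [RiemannianBundle (fun (x : M) ↦ TangentSpace I x)]

/-- The norm of the inverse of the derivative is the norm of the derivative of the inverse. -/
theorem norm_inverse_mfderiv {F G : M → M} (hF : MDifferentiable I I F)
    (hG : MDifferentiable I I G) (hGF : Function.LeftInverse G F)
    (hFG : Function.RightInverse G F) (y : M) :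
    ‖(mfderiv I I F y).inverse‖ = ‖mfderiv I I G (F y)‖ := by
  let B : TangentSpace I (F y) →L[ℝ] TangentSpace I y := show E →L[ℝ] E from mfderiv I I G (F y)
  have hinv : (mfderiv I I F y).inverse = B := by
    apply ContinuousLinearMap.inverse_eq
    · ext v
      have h := mfderiv_comp_mfderiv_apply_of_leftInverse (hG (F y)) (hF _) hFG v
      rw [hGF y] at h
      exact h
    · ext v
      exact mfderiv_comp_mfderiv_apply_of_leftInverse (hF y) (hG _) hGF v
  rw [hinv]
  exact norm_eq_of_apply_eq (hGF y).symm _ _ fun v ↦ rfl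

/-- An injective linear map on a nonzero space is nonzero. This rules out the default value
`Real.log 0 = 0`. -/
theorem norm_mfderiv_pos_of_leftInverse [Nontrivial E] {F G : M → M}
    (hF : MDifferentiable I I F) (hG : MDifferentiable I I G) (h : Function.LeftInverse G F)
    (y : M) : 0 < ‖mfderiv I I F y‖ := by
  obtain ⟨v, hv⟩ := exists_ne (0 : E)
  by_contra hle
  have h0 : ‖mfderiv I I F y‖ = 0 := le_antisymm (not_lt.1 hle) (ContinuousLinearMap.opNorm_nonneg _)
  have h1 : mfderiv I I F y v = 0 := by
    have h2 := ContinuousLinearMap.le_opNorm (mfderiv I I F y) v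
    rw [h0, zero_mul] at h2
    exact norm_le_zero_iff.1 h2
  have h3 := mfderiv_comp_mfderiv_apply_of_leftInverse (hF y) (hG _) h v
  rw [h1, map_zero] at h3
  exact hv h3.symm

theorem logNormInvDeriv_eq (f : M ≃ₘ^1⟮I, I⟯ M) (k : ℕ) (y : M) :
    logNormInvDeriv I f k y = Real.log ‖mfderiv I I (f.symm^[k]) (f^[k] y)‖ := by
  rw [logNormInvDeriv, norm_inverse_mfderiv
    ((f.contMDiff.iterate k).mdifferentiable one_ne_zero)
    ((f.symm.contMDiff.iterate k).mdifferentiable one_ne_zero)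
    (Function.LeftInverse.iterate f.left_inv k) (Function.LeftInverse.iterate f.right_inv k)]

variable [IsManifold I 1 M] [IsRiemannianManifold I M] [CompactSpace M]
  [IsContinuousRiemannianBundle E (fun (x : M) ↦ TangentSpace I x)]

theorem exists_isRepellingPeriodicOrbit_of_liminf_lt_zero [Nontrivial E] (f : M ≃ₘ^1⟮I, I⟯ M)
    {x : M} {k : ℕ} (hk : 0 < k) (hx : liminfAvgLogNormInvDeriv I f k x < 0) :
    ∃ O : Set M, IsRepellingPeriodicOrbit f.toEquiv O ∧ x ∈ O := by
  let g : M ≃ M := ⟨f^[k], f.symm^[k], Function.LeftInverse.iterate f.left_inv k,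
    Function.LeftInverse.iterate f.right_inv k⟩
  have hsm : ContMDiff I I 1 (f.symm^[k]) := f.symm.contMDiff.iterate k
  have hpos : ∀ y, 0 < ‖mfderiv I I (f.symm^[k]) y‖ := norm_mfderiv_pos_of_leftInverse
    (hsm.mdifferentiable one_ne_zero) ((f.contMDiff.iterate k).mdifferentiable one_ne_zero)
    (Function.LeftInverse.iterate f.right_inv k)
  obtain ⟨c, hc, hcx⟩ : ∃ c : ℝ, c < 0 ∧ liminfAvgLogNormInvDeriv I f k x < c := by
    obtain ⟨c, hc1, hc2⟩ := EReal.lt_iff_exists_real_btwn.1 hx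
    exact ⟨c, by exact_mod_cast hc2, hc1⟩
  have hfreq := frequently_lt_of_liminf_lt (by isBoundedDefault) hcx
  obtain ⟨m, hm, p, hp, ⟨i, hi, hxi⟩, V, hV, hmaps, b, hb0, hb1, hcontr⟩ :=
    exists_repelling_of_frequently_sum_le g (fun z ↦ Real.log ‖mfderiv I I (f.symm^[k]) z‖)
      (fun ε hε ↦ exists_dist_le_exp_log_norm_mfderiv hsm hpos hε) x (neg_pos.2 hc) (by
        refine (hfreq.and_eventually (eventually_gt_atTop 0)).mono fun n ⟨hn, hn0⟩ ↦ ?_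
        have hn' := EReal.coe_lt_coe_iff.1 hn
        have hn0' : (0 : ℝ) < n := by exact_mod_cast hn0
        -- The shift `i + 1` arises because the inverse of `Df^k` at `y` is the derivative of `f⁻ᵏ`
        -- at `f^k y`.
        have hsum : ∑ i ∈ Finset.range n, Real.log ‖mfderiv I I (f.symm^[k]) (g^[i + 1] x)‖ =
            ∑ j ∈ Finset.range n, logNormInvDeriv I f k (f^[k * j] x) := by
          refine Finset.sum_congr rfl fun j _ ↦ ?_
          rw [logNormInvDeriv_eq, Function.iterate_succ_apply', Function.iterate_mul]
          rfl
        rw [hsum, neg_neg]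
        rw [inv_mul_lt_iff₀ hn0'] at hn'
        linarith)
  have hg : ∀ n, g.symm^[n] = f.symm^[k * n] := fun n ↦ (Function.iterate_mul _ k n).symm
  rw [hg] at hp hmaps hxi
  rw [hg] at hcontr
  refine ⟨_, ⟨p, k * m, by positivity, hp, rfl, V, hV, hmaps, b, hb0, hb1, hcontr⟩,
    k * i, by gcongr, hxi⟩

/-- If `h^τ` contracts a neighbourhood of its fixed point `p`, then the iterates of `h^τ` are
Lipschitz at any point of the orbit of `p`, with exponentially decreasing constants. -/
theorem exists_eventually_dist_iterate_le {h h' : M → M} (hh : ContMDiff I I 1 h)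
    (hh' : ContMDiff I I 1 h') (hl : Function.LeftInverse h' h) (hr : Function.RightInverse h' h)
    {p : M} {τ : ℕ} (i : ℕ) (hp : h^[τ] p = p) {V : Set M} (hV : V ∈ 𝓝 p)
    (hmaps : MapsTo (h^[τ]) V V) {c : ℝ} (hc0 : 0 < c) (hc1 : c < 1)
    (hcontr : ∀ q ∈ V, ∀ r ∈ V, dist (h^[τ] q) (h^[τ] r) ≤ c * dist q r) :
    ∃ L, 0 ≤ L ∧ ∀ N : ℕ, ∀ᶠ y in 𝓝 (h^[i] p),
      dist (h^[τ * N] y) (h^[i] p) ≤ (L * c ^ N) * dist y (h^[i] p) := by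
  obtain ⟨C₁, hC₁0, δ₁, hδ₁, hC₁⟩ := exists_forall_dist_le (hh.iterate i)
  obtain ⟨C₂, hC₂0, δ₂, hδ₂, hC₂⟩ := exists_forall_dist_le (hh'.iterate i)
  have hpV : p ∈ V := mem_of_mem_nhds hV
  have hit : ∀ N : ℕ, ∀ q ∈ V, dist (h^[τ * N] q) p ≤ c ^ N * dist q p := by
    intro N
    induction N with
    | zero => intro q _; simp
    | succ N ih =>
      intro q hq
      rw [mul_add, mul_one, Function.iterate_add_apply]
      have h1 := hcontr q hq p hpV
      rw [hp] at h1
      calc _ ≤ c ^ N * dist (h^[τ] q) p := ih _ (hmaps hq)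
        _ ≤ c ^ N * (c * dist q p) := by gcongr
        _ = _ := by ring
  -- Near `h^i p`, write `h^(τN) = h^i ∘ h^(τN) ∘ h^(-i)`: the outer factors cost `C₁` and `C₂`,
  -- independently of `N`.
  refine ⟨C₁ * C₂, by positivity, fun N ↦ ?_⟩
  have hback : h'^[i] (h^[i] p) = p := (hl.iterate i) p
  have hcont : Tendsto (h'^[i]) (𝓝 (h^[i] p)) (𝓝 p) := by
    have := (hh'.iterate i).continuous.tendsto (h^[i] p)
    rwa [hback] at this
  filter_upwards [hcont.eventually hV, hcont.eventually (Metric.ball_mem_nhds p hδ₁),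
    Metric.ball_mem_nhds _ hδ₂] with y h1 h2 h3
  have h4 : dist (h'^[i] y) p ≤ C₂ * dist y (h^[i] p) := by
    have := hC₂ y (h^[i] p) h3
    rwa [hback] at this
  have h5 := hit N _ h1
  have h6 : dist (h^[τ * N] (h'^[i] y)) p < δ₁ :=
    (h5.trans (mul_le_of_le_one_left dist_nonneg (pow_le_one₀ hc0.le hc1.le))).trans_lt h2
  have h7 := hC₁ _ _ h6
  rw [← Function.iterate_add_apply, add_comm, Function.iterate_add_apply,
    (Function.LeftInverse.iterate hr i) y] at h7
  calc _ ≤ C₁ * dist (h^[τ * N] (h'^[i] y)) p := h7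
    _ ≤ C₁ * (c ^ N * (C₂ * dist y (h^[i] p))) := by
      gcongr
      exact h5.trans (by gcongr)
    _ = _ := by ring

theorem exists_liminf_lt_zero_of_isRepellingPeriodicOrbit [FiniteDimensional ℝ E] [Nontrivial E]
    (f : M ≃ₘ^1⟮I, I⟯ M) {x : M} {O : Set M} (hO : IsRepellingPeriodicOrbit f.toEquiv O)
    (hx : x ∈ O) : ∃ k : ℕ, 0 < k ∧ liminfAvgLogNormInvDeriv I f k x < 0 := by
  obtain ⟨p, τ, hτ, hp, rfl, V, hV, hmaps, c, hc0, hc1, hcontr⟩ := hO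
  obtain ⟨i, -, rfl⟩ := hx
  change f.symm^[τ] p = p at hp
  change MapsTo (f.symm^[τ]) V V at hmaps
  change ∀ q ∈ V, ∀ r ∈ V, dist (f.symm^[τ] q) (f.symm^[τ] r) ≤ c * dist q r at hcontr
  change ∃ k : ℕ, 0 < k ∧ liminfAvgLogNormInvDeriv I f k (f.symm^[i] p) < 0
  have hsm : ∀ n, ContMDiff I I 1 (f.symm^[n]) := fun n ↦ f.symm.contMDiff.iterate n
  obtain ⟨L, hL0, hL⟩ := exists_eventually_dist_iterate_le f.symm.contMDiff f.contMDiff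
    f.right_inv f.left_inv i hp hV hmaps hc0 hc1 hcontr
  set x := f.symm^[i] p with hxdef
  have hfix : ∀ N, f.symm^[τ * N] x = x := by
    intro N
    have h1 : Function.IsPeriodicPt f.symm (τ * N) p := Function.IsPeriodicPt.mul_const hp N
    exact h1.apply_iterate i
  have hlt := eventually_norm_mfderiv_lt_one (I := I) (x := x) (h := fun N ↦ f.symm^[τ * N])
    (K := fun N ↦ L * c ^ N) (fun N ↦ (hsm _).mdifferentiable one_ne_zero x) hfix
    (fun N ↦ by positivity)
    (by simpa using (tendsto_pow_atTop_nhds_zero_of_lt_one hc0.le hc1).const_mul L) hL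
  obtain ⟨N, hN, hN0⟩ := (hlt.and (eventually_gt_atTop 0)).exists
  have hk : 0 < τ * N := by positivity
  refine ⟨τ * N, hk, ?_⟩
  set k := τ * N
  have hffix : f^[k] x = x := by
    conv_lhs => rw [← hfix N]
    exact (Function.LeftInverse.iterate f.right_inv k) x
  -- Since `f^k` fixes `x`, all terms of the Birkhoff sum coincide, so the averages are constant for
  -- `n > 0`.
  have hval : ∀ j, logNormInvDeriv I f k (f^[k * j] x) =
      Real.log ‖mfderiv I I (f.symm^[k]) x‖ := by
    intro j
    have h1 : f^[k * j] x = x := Function.IsPeriodicPt.mul_const hffix j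
    rw [h1, logNormInvDeriv_eq, hffix]
  have hneg : Real.log ‖mfderiv I I (f.symm^[k]) x‖ < 0 :=
    Real.log_neg (norm_mfderiv_pos_of_leftInverse ((hsm k).mdifferentiable one_ne_zero)
      ((f.contMDiff.iterate k).mdifferentiable one_ne_zero)
      (Function.LeftInverse.iterate f.right_inv k) x) hN
  have hlim : liminfAvgLogNormInvDeriv I f k x =
      ((Real.log ‖mfderiv I I (f.symm^[k]) x‖ : ℝ) : EReal) := by
    refine Tendsto.liminf_eq (tendsto_const_nhds.congr' ?_)
    filter_upwards [eventually_gt_atTop 0] with n hn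
    have hn' : (n : ℝ) ≠ 0 := by positivity
    simp only [hval, Finset.sum_const, Finset.card_range, nsmul_eq_mul]
    rw [inv_mul_cancel_left₀ hn']
  rw [hlim]
  exact_mod_cast hneg

end

theorem theoremB
    {E : Type*} [NormedAddCommGroup E] [NormedSpace ℝ E] [FiniteDimensional ℝ E]
    (hd : 2 ≤ Module.finrank ℝ E)
    {H : Type*} [TopologicalSpace H] (I : ModelWithCorners ℝ E H)
    {M : Type*} [MetricSpace M] [CompactSpace M] [ConnectedSpace M]
    [ChartedSpace H M] [IsManifold I ∞ M]
    [RiemannianBundle (fun (x : M) ↦ TangentSpace I x)]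
    [IsContMDiffRiemannianBundle I ∞ E (fun (x : M) ↦ TangentSpace I x)]
    [IsRiemannianManifold I M]
    (f : M ≃ₘ^1⟮I, I⟯ M) (x : M) :
    (∃ O : Set M, IsRepellingPeriodicOrbit f.toEquiv O ∧ x ∈ O) ↔
      ∃ k : ℕ, 0 < k ∧ liminfAvgLogNormInvDeriv I f k x < 0 := by
  
  have : Nontrivial E := Module.nontrivial_of_finrank_pos (R := ℝ) (by omega)
  have : IsContinuousRiemannianBundle E (fun (x : M) ↦ TangentSpace I x) := by
    obtain ⟨g, hg, hinner⟩ := IsContMDiffRiemannianBundle.exists_contMDiff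
      (IB := I) (n := ∞) (F := E) (E := fun (x : M) ↦ TangentSpace I x)
    exact ⟨g, hg.continuous, hinner⟩
  have : IsManifold I 1 M := IsManifold.of_le (n := ∞) (by simp)
  exact ⟨fun ⟨O, hO, hx⟩ ↦ exists_liminf_lt_zero_of_isRepellingPeriodicOrbit f hO hx,
    fun ⟨k, hk, hx⟩ ↦ exists_isRepellingPeriodicOrbit_of_liminf_lt_zero f hk hx⟩
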